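/- Let $X$ be a locally compact, second countable Hausdorff topological space equipped with a Radon measure $\lambda$, let $\Gamma$ be a locally compact, second countable topological group acting continuously on $X$ and preserving $\lambda$, and let $\mu$ be a Borel probability measure on $\Gamma$ whose support generates $\Gamma$ as a closed group (i.e. the subgroup generated by the support of $\mu$ is dense in $\Gamma$). Call a measurable set $A\subseteq X$ $\Gamma$-invariant if $\lambda(gA\,\Delta\,A)=0$ for every $g\in\Gamma$, and assume that every measurable $\Gamma$-invariant subset of $X$ has zero or infinite $\lambda$-measure. Write $\mu^{*n}*\delta_x$ for the image of $\mu^{\otimes n}$ under $(g_1,\dots,g_n)\mapsto g_1\cdots g_n x$ (so $\mu^{*0}*\delta_x=\delta_x$), and let weak-$*$ convergence of measures on $X$ mean convergence of the integrals of every continuous compactly supported function $X\to\mathbb{R}$. (1) If $\mu$ is symmetric, i.e. invariant under $g\mapsto g^{-1}$, then for $\lambda$-almost every $x\in X$ one has the weak-$*$ convergence $$\mu^{*n}*\delta_x\longrightarrow 0\qquad (n\to+\infty).$$ (2) Without assuming that $\mu$ is symmetric, for $\lambda$-almost every $x\in X$ one has the weak-$*$ convergence $$\frac1n\sum_{k=0}^{n-1}\mu^{*k}*\delta_x\longrightarrow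 0\qquad (n\to+\infty).$$ -/

import Mathlib

open MeasureTheory Filter Topology
open scoped Pointwise symmDiff ENNReal CompactlySupported

namespace RandomWalk

/-- The convolution `μ * ν` of a measure `μ` on `Γ` with a measure `ν` on a space `X` on which `Γ`
acts: the image of `μ ⊗ ν` under the action map `(g, x) ↦ g • x`. -/
noncomputable def actConv {Γ X : Type*} [SMul Γ X] [MeasurableSpace Γ] [MeasurableSpace X]
    (μ : Measure Γ) (ν : Measure X) : Measure X :=
  (μ.prod ν).map (fun p : Γ × X => p.1 • p.2)

/-- The `n`-fold convolution power `μ^{*n}` of a measure on a group, with `μ^{*0} = δ_1`. -/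
noncomputable def convPow {Γ : Type*} [Group Γ] [MeasurableSpace Γ] (μ : Measure Γ) :
    ℕ → Measure Γ
  | 0 => Measure.dirac 1
  | n + 1 => Measure.mconv μ (convPow μ n)

/-- The law `μ^{*n} * δ_x` at time `n` of the `μ`-random walk on `X` starting at `x`. -/
noncomputable def walkLaw {Γ X : Type*} [Group Γ] [MulAction Γ X] [MeasurableSpace Γ]
    [MeasurableSpace X] (μ : Measure Γ) (n : ℕ) (x : X) : Measure X :=
  actConv (convPow μ n) (Measure.dirac x)

/-- The Cesàro average `(1/n) ∑_{k < n} μ^{*k} * δ_x`. -/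
noncomputable def cesaroLaw {Γ X : Type*} [Group Γ] [MulAction Γ X] [MeasurableSpace Γ]
    [MeasurableSpace X] (μ : Measure Γ) (n : ℕ) (x : X) : Measure X :=
  (n : ℝ≥0∞)⁻¹ • ∑ k ∈ Finset.range n, walkLaw μ k x

/-- Weak-* convergence of a sequence of measures, tested against continuous functions with
compact support. -/
def WeakStarTendsto {X : Type*} [TopologicalSpace X] [MeasurableSpace X]
    (ν : ℕ → Measure X) (ν' : Measure X) : Prop :=
  ∀ f : C_c(X, ℝ), Tendsto (fun n => ∫ y, f y ∂(ν n)) atTop (𝓝 (∫ y, f y ∂ν'))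

/-- A subset `A` of `X` is `Γ`-invariant (relative to `lam`) if `lam (g A ∆ A) = 0` for every
`g` in `Γ`. -/
def IsInvariantSet (Γ : Type*) {X : Type*} [Group Γ] [MulAction Γ X] [MeasurableSpace X]
    (lam : Measure X) (A : Set X) : Prop :=
  ∀ g : Γ, lam ((g • A) ∆ A) = 0

/-- The support of `μ` generates `Γ` as a closed group: the smallest closed subgroup containing
the support is `Γ`. -/
def SupportGenerates {Γ : Type*} [Group Γ] [TopologicalSpace Γ] [IsTopologicalGroup Γ]
    [MeasurableSpace Γ] (μ : Measure Γ) : Prop :=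
  (Subgroup.closure μ.support).topologicalClosure = ⊤

end RandomWalk

/-! Let `P` be the transition operator. Its iterates on indicators give the walk laws, it preserves
`lam`-integrals, and compact sets have finite measure, so it suffices to study `P^n f` for bounded
integrable `f ≥ 0`.

Cesàro case: let `φ` be the upper limit of the averages of `P^k f`. Hopf's maximal inequality makes
`{φ > ε}` of finite measure, and reverse Fatou makes `φ` subharmonic. Then `(φ - ε)⁺` is subharmonic
and square-integrable, hence invariant under `μ`-almost every `g` (`ae_ae_eq_of_le_transition`). So
`{φ > ε}` is `Γ`-invariant of finite measure, hence null, and `φ = 0` almost everywhere.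

Symmetric case: `P` is self-adjoint, so `a n = ⟨f, P^(2n) f⟩` is nonnegative, decreasing and convex.
This gives `∑ (k+1) ‖P^(2k) f - P^(2k+2) f‖² < ∞`, a pointwise almost everywhere Tauberian condition
upgrading Cesàro convergence to convergence of the even iterates. Applying this to `P f` handles the
odd ones. -/

namespace RandomWalk

/-! ### The transition operator: invariance of integrals and self-adjointness. -/

section Transition

variable {Γ X : Type*} [Group Γ] [MulAction Γ X] [MeasurableSpace Γ]

/-- The transition operator of the `μ`-random walk, acting on nonnegative functions. -/
noncomputable def transition (μ : Measure Γ) (f : X → ℝ≥0∞) (x : X) : ℝ≥0∞ :=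
  ∫⁻ g, f (g • x) ∂μ

theorem transition_mono (μ : Measure Γ) : Monotone (transition (X := X) μ) :=
  fun _ _ h _ => lintegral_mono fun _ => h _

theorem transition_const (μ : Measure Γ) [IsProbabilityMeasure μ] (c : ℝ≥0∞) :
    transition (X := X) μ (fun _ => c) = fun _ => c := by
  ext x; simp [transition]

theorem transition_iterate_le_const (μ : Measure Γ) [IsProbabilityMeasure μ] {f : X → ℝ≥0∞}
    {c : ℝ≥0∞} (hf : ∀ x, f x ≤ c) (n : ℕ) (x : X) : (transition μ)^[n] f x ≤ c := by
  induction n generalizing x with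
  | zero => exact hf x
  | succ n ih =>
    rw [Function.iterate_succ_apply']
    exact (transition_mono μ (show _ ≤ fun _ => c from ih) x).trans_eq
      (congrFun (transition_const μ c) x)

variable [MeasurableSpace X] [MeasurableSMul₂ Γ X]

theorem measurable_transition (μ : Measure Γ) [SFinite μ] {f : X → ℝ≥0∞} (hf : Measurable f) :
    Measurable (transition μ f) := by
  unfold transition
  exact Measurable.lintegral_prod_right' (f := fun p : X × Γ => f (p.2 • p.1)) (by fun_prop)

theorem measurable_transition_iterate (μ : Measure Γ) [SFinite μ] {f : X → ℝ≥0∞}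
    (hf : Measurable f) (n : ℕ) : Measurable ((transition μ)^[n] f) := by
  induction n with
  | zero => exact hf
  | succ n ih =>
    rw [Function.iterate_succ_apply']
    exact measurable_transition μ ih

theorem transition_add (μ : Measure Γ) {f : X → ℝ≥0∞} (hf : Measurable f) (h : X → ℝ≥0∞) :
    transition μ (f + h) = transition μ f + transition μ h := by
  ext x
  exact lintegral_add_left (by fun_prop) _

theorem transition_const_mul (μ : Measure Γ) (c : ℝ≥0∞) {f : X → ℝ≥0∞} (hf : Measurable f)
    (x : X) : transition μ (fun y => c * f y) x = c * transition μ f x :=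
  lintegral_const_mul _ (by fun_prop)

theorem transition_sum (μ : Measure Γ) {ι : Type*} (s : Finset ι) {f : ι → X → ℝ≥0∞}
    (hf : ∀ i ∈ s, Measurable (f i)) (x : X) :
    transition μ (fun y => ∑ i ∈ s, f i y) x = ∑ i ∈ s, transition μ (f i) x :=
  lintegral_finsetSum _ fun i hi => (hf i hi).comp (by fun_prop)

theorem lintegral_comp_smul {lam : Measure X} [SMulInvariantMeasure Γ X lam] {f : X → ℝ≥0∞}
    (hf : Measurable f) (g : Γ) : ∫⁻ x, f (g • x) ∂lam = ∫⁻ x, f x ∂lam :=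
  (measurePreserving_smul g lam).lintegral_comp hf

theorem lintegral_transition {lam : Measure X} [SFinite lam] [SMulInvariantMeasure Γ X lam]
    (μ : Measure Γ) [IsProbabilityMeasure μ] {f : X → ℝ≥0∞} (hf : Measurable f) :
    ∫⁻ x, transition μ f x ∂lam = ∫⁻ x, f x ∂lam := by
  unfold transition
  rw [lintegral_lintegral_swap (by fun_prop)]
  simp [lintegral_comp_smul hf]

theorem lintegral_transition_iterate {lam : Measure X} [SFinite lam]
    [SMulInvariantMeasure Γ X lam] (μ : Measure Γ) [IsProbabilityMeasure μ] {f : X → ℝ≥0∞}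
    (hf : Measurable f) (n : ℕ) :
    ∫⁻ x, (transition μ)^[n] f x ∂lam = ∫⁻ x, f x ∂lam := by
  induction n with
  | zero => rfl
  | succ n ih =>
    rw [Function.iterate_succ_apply',
      lintegral_transition μ (measurable_transition_iterate μ hf n), ih]

/-- Substitute `x ↦ g⁻¹ x` using invariance of `lam`, then `g ↦ g⁻¹` using symmetry of `μ`. -/
theorem lintegral_transition_mul_comm {lam : Measure X} [SFinite lam]
    [SMulInvariantMeasure Γ X lam] [MeasurableInv Γ] (μ : Measure Γ) [IsProbabilityMeasure μ]
    (hμ : μ.inv = μ) {u v : X → ℝ≥0∞} (hu : Measurable u) (hv : Measurable v) :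
    ∫⁻ x, transition μ u x * v x ∂lam = ∫⁻ x, u x * transition μ v x ∂lam := by
  have h1 : ∀ x, transition μ u x * v x = ∫⁻ g, u (g • x) * v x ∂μ := fun x =>
    (lintegral_mul_const _ (by fun_prop)).symm
  have h2 : ∀ x, u x * transition μ v x = ∫⁻ g, u x * v (g • x) ∂μ := fun x =>
    (lintegral_const_mul _ (by fun_prop)).symm
  simp_rw [h1, h2]
  rw [lintegral_lintegral_swap (f := fun x (g : Γ) => u (g • x) * v x) (by fun_prop),
    lintegral_lintegral_swap (f := fun x (g : Γ) => u x * v (g • x)) (by fun_prop)]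
  have h3 : ∀ g : Γ, ∫⁻ x, u (g • x) * v x ∂lam = ∫⁻ x, u x * v (g⁻¹ • x) ∂lam := fun g => by
    rw [← lintegral_comp_smul (Γ := Γ) (f := fun x => u x * v (g⁻¹ • x)) (by fun_prop) g]
    simp only [inv_smul_smul]
  rw [lintegral_congr h3]
  have h4 : Measurable fun g : Γ => ∫⁻ x, u x * v (g • x) ∂lam :=
    Measurable.lintegral_prod_right' (f := fun p : Γ × X => u p.2 * v (p.1 • p.2)) (by fun_prop)
  conv_rhs => rw [← hμ]
  rw [Measure.inv, lintegral_map h4 measurable_inv]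

end Transition

/-! ### Walk laws as iterates of the transition operator. -/

section WalkLaw

variable {Γ X : Type*} [Group Γ] [MulAction Γ X] [MeasurableSpace Γ] [MeasurableSpace X]
  [MeasurableMul₂ Γ]

instance isProbabilityMeasure_convPow (μ : Measure Γ) [IsProbabilityMeasure μ] (n : ℕ) :
    IsProbabilityMeasure (convPow μ n) := by
  induction n with
  | zero => exact Measure.dirac.isProbabilityMeasure
  | succ n ih => exact Measure.isProbabilityMeasure_map (by fun_prop)

variable [MeasurableSMul₂ Γ X]

theorem lintegral_walkLaw (μ : Measure Γ) [IsProbabilityMeasure μ] (n : ℕ) (x : X)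
    {f : X → ℝ≥0∞} (hf : Measurable f) :
    ∫⁻ y, f y ∂(walkLaw μ n x) = (transition μ)^[n] f x := by
  have hconv : ∫⁻ y, f y ∂(walkLaw μ n x) = ∫⁻ g, f (g • x) ∂(convPow μ n) := by
    rw [walkLaw, actConv, lintegral_map hf (by fun_prop), lintegral_prod _ (by fun_prop)]
    exact lintegral_congr fun g => lintegral_dirac' x (by fun_prop)
  rw [hconv]
  clear hconv
  induction n generalizing f with
  | zero =>
    rw [convPow, lintegral_dirac' _ (by fun_prop)]
    simp
  | succ n ih =>
    -- The new factor of `convPow` stands on the left; integrating it first replaces `f` by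
    -- `transition μ f`, hence the induction over all `f`.
    rw [convPow, Measure.mconv, lintegral_map (by fun_prop) (by fun_prop),
      lintegral_prod_symm _ (by fun_prop), Function.iterate_succ_apply,
      ← ih (measurable_transition μ hf)]
    simp [transition, mul_smul]

theorem walkLaw_apply (μ : Measure Γ) [IsProbabilityMeasure μ] (n : ℕ) (x : X) {K : Set X}
    (hK : MeasurableSet K) : walkLaw μ n x K = (transition μ)^[n] (K.indicator 1) x := by
  rw [← lintegral_walkLaw μ n x (measurable_one.indicator hK), lintegral_indicator_one hK]

end WalkLaw

/-! ### The maximal inequality by the filling scheme. -/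

section Maximal

variable {Γ X : Type*} [Group Γ] [MulAction Γ X] [MeasurableSpace Γ]

/-- The sum of the first `n` iterates of the transition operator. -/
noncomputable def transitionSum (μ : Measure Γ) (f : X → ℝ≥0∞) (n : ℕ) (x : X) : ℝ≥0∞ :=
  ∑ k ∈ Finset.range n, (transition μ)^[k] f x

/-- The filling scheme: at each step the mass moves by the transition operator, `f` is added, and
as much as possible of `b` is removed. -/
noncomputable def filling (μ : Measure Γ) (f b : X → ℝ≥0∞) : ℕ → X → ℝ≥0∞
  | 0 => 0
  | n + 1 => f + transition μ (filling μ f b n) - b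

theorem filling_le_succ (μ : Measure Γ) (f b : X → ℝ≥0∞) (n : ℕ) :
    filling μ f b n ≤ filling μ f b (n + 1) := by
  induction n with
  | zero => exact fun _ => zero_le
  | succ n ih =>
    intro x
    simp only [filling, Pi.sub_apply, Pi.add_apply]
    gcongr
    exact transition_mono μ ih x

variable [MeasurableSpace X] [MeasurableSMul₂ Γ X]

theorem measurable_transitionSum (μ : Measure Γ) [SFinite μ] {f : X → ℝ≥0∞} (hf : Measurable f)
    (n : ℕ) : Measurable (transitionSum μ f n) :=
  Finset.measurable_fun_sum _ fun k _ => measurable_transition_iterate μ hf k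

theorem transitionSum_succ (μ : Measure Γ) [SFinite μ] {f : X → ℝ≥0∞} (hf : Measurable f) (n : ℕ) :
    transitionSum μ f (n + 1) = f + transition μ (transitionSum μ f n) := by
  ext x
  rw [Pi.add_apply]
  unfold transitionSum
  rw [transition_sum μ _ fun k _ => measurable_transition_iterate μ hf k,
    Finset.sum_range_succ', add_comm]
  simp [Function.iterate_succ_apply']

theorem measurable_filling (μ : Measure Γ) [SFinite μ] {f b : X → ℝ≥0∞} (hf : Measurable f)
    (hb : Measurable b) (n : ℕ) : Measurable (filling μ f b n) := by
  induction n with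
  | zero => exact measurable_zero
  | succ n ih => exact (hf.add (measurable_transition μ ih)).sub hb

/-- Mass balance: each step removes at most `b`, and removed mass would only have been transported
further by the operator. -/
theorem transitionSum_le_filling_add (μ : Measure Γ) [SFinite μ] {f b : X → ℝ≥0∞}
    (hf : Measurable f) (hb : Measurable b) (n : ℕ) :
    transitionSum μ f n ≤ filling μ f b n + transitionSum μ b n := by
  induction n with
  | zero => intro x; simp [transitionSum]
  | succ n ih =>
    rw [transitionSum_succ μ hf, transitionSum_succ μ hb]
    calc f + transition μ (transitionSum μ f n)
        ≤ f + (transition μ (filling μ f b n) + transition μ (transitionSum μ b n)) := by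
          gcongr
          rw [← transition_add μ (measurable_filling μ hf hb n)]
          exact transition_mono μ ih
      _ = (f + transition μ (filling μ f b n)) + transition μ (transitionSum μ b n) := by
          rw [add_assoc]
      _ ≤ (f + transition μ (filling μ f b n) - b + b) + transition μ (transitionSum μ b n) := by
          exact add_le_add (fun x => le_tsub_add (α := ℝ≥0∞)) le_rfl
      _ = _ := by rw [filling, add_assoc]

theorem lintegral_filling_ne_top {lam : Measure X} [SFinite lam] [SMulInvariantMeasure Γ X lam]
    (μ : Measure Γ) [IsProbabilityMeasure μ] {f b : X → ℝ≥0∞} (hf : Measurable f)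
    (hb : Measurable b) (hfi : ∫⁻ x, f x ∂lam ≠ ∞) (n : ℕ) :
    ∫⁻ x, filling μ f b n x ∂lam ≠ ∞ := by
  induction n with
  | zero => simp [filling]
  | succ n ih =>
    refine ne_top_of_le_ne_top (ENNReal.add_ne_top.2 ⟨hfi, ih⟩) ?_
    rw [← lintegral_transition μ (measurable_filling μ hf hb n), ← lintegral_add_left hf]
    exact lintegral_mono fun x => tsub_le_self

/-- Where the filling is positive the truncated subtraction is exact, so all of `b` was removed
there; the total removed cannot exceed the mass `f` added, because the filling increases with `n`.
-/
theorem setLIntegral_filling_pos_le {lam : Measure X} [SFinite lam]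
    [SMulInvariantMeasure Γ X lam] (μ : Measure Γ) [IsProbabilityMeasure μ] {f b : X → ℝ≥0∞}
    (hf : Measurable f) (hb : Measurable b) (hfi : ∫⁻ x, f x ∂lam ≠ ∞) (n : ℕ) :
    ∫⁻ x in {x | 0 < filling μ f b n x}, b x ∂lam ≤ ∫⁻ x, f x ∂lam := by
  have hm := measurable_filling μ hf hb
  cases n with
  | zero => simp [filling]
  | succ n =>
    have hE : MeasurableSet {x | 0 < filling μ f b (n + 1) x} :=
      measurableSet_lt measurable_const (hm _)
    rw [← lintegral_indicator hE]
    refine ENNReal.le_of_add_le_add_left (lintegral_filling_ne_top μ hf hb hfi (n + 1)) ?_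
    rw [← lintegral_add_left (hm _)]
    calc _ ≤ ∫⁻ x, f x + transition μ (filling μ f b n) x ∂lam := by
          refine lintegral_mono fun x => ?_
          by_cases hx : 0 < filling μ f b (n + 1) x
          · rw [Set.indicator_of_mem (by exact hx)]
            exact (tsub_add_cancel_of_le (tsub_pos_iff_lt.1 hx).le).le
          · rw [Set.indicator_of_notMem (by exact hx)]
            simp [nonpos_iff_eq_zero.1 (not_lt.1 hx)]
      _ = ∫⁻ x, filling μ f b n x ∂lam + ∫⁻ x, f x ∂lam := by
          rw [lintegral_add_left hf, lintegral_transition μ (hm n), add_comm]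
      _ ≤ _ := by
          gcongr
          exact filling_le_succ μ f b n _

/-- **Hopf's maximal ergodic inequality** for the transition operator. -/
theorem mul_measure_exists_transitionSum_le {lam : Measure X} [SFinite lam]
    [SMulInvariantMeasure Γ X lam] (μ : Measure Γ) [IsProbabilityMeasure μ] {f : X → ℝ≥0∞}
    (hf : Measurable f) (hfi : ∫⁻ x, f x ∂lam ≠ ∞) (ε : ℝ≥0∞) :
    ε * lam {x | ∃ n : ℕ, n * ε < transitionSum μ f n x} ≤ ∫⁻ x, f x ∂lam := by
  have hS := measurable_transitionSum μ hf
  set B : ℕ → Set X := fun N => {x | ∃ n ≤ N, n * ε < transitionSum μ f n x} with hB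
  have hBm : ∀ N, MeasurableSet (B N) := fun N => by
    have : B N = ⋃ n ∈ Set.Iic N, {x | n * ε < transitionSum μ f n x} := by
      ext x; simp [hB]
    rw [this]
    exact MeasurableSet.biUnion (Set.to_countable _) fun n _ =>
      measurableSet_lt measurable_const (hS n)
  have hmono : Monotone B := fun N M h x ⟨n, hn, hx⟩ => ⟨n, hn.trans h, hx⟩
  have hU : {x | ∃ n : ℕ, n * ε < transitionSum μ f n x} = ⋃ N, B N := by
    ext x
    simp only [Set.mem_ofPred_eq, Set.mem_iUnion, hB]
    exact ⟨fun ⟨n, hn⟩ => ⟨n, n, le_rfl, hn⟩, fun ⟨_, n, _, hn⟩ => ⟨n, hn⟩⟩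
  rw [hU, hmono.measure_iUnion, ENNReal.mul_iSup]
  refine iSup_le fun N => ?_
  -- With capacity `ε` on `B N`, at most `n * ε` is removed in `n` steps, so `n * ε < transitionSum
  -- μ f n x` leaves a positive filling at `x`.
  set b : X → ℝ≥0∞ := (B N).indicator fun _ => ε with hb
  have hbm : Measurable b := measurable_const.indicator (hBm N)
  have hsub : B N ⊆ {x | 0 < filling μ f b N x} := by
    rintro x ⟨n, hn, hx⟩
    have h1 := transitionSum_le_filling_add μ hf hbm n x
    have h2 : transitionSum μ b n x ≤ n * ε := by
      unfold transitionSum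
      refine (Finset.sum_le_sum fun k _ => transition_iterate_le_const μ
        (c := ε) (fun y => ?_) k x).trans_eq (by simp)
      exact Set.indicator_le_self' (fun _ _ => zero_le) y
    have h3 : filling μ f b n x ≤ filling μ f b N x :=
      monotone_nat_of_le_succ (filling_le_succ μ f b) hn x
    refine lt_of_lt_of_le (pos_iff_ne_zero.2 fun h0 => ?_) h3
    rw [Pi.add_apply, h0, zero_add] at h1
    exact absurd hx (not_lt.2 (h1.trans h2))
  calc ε * lam (B N) = ∫⁻ x in B N, b x ∂lam := by
        rw [hb, setLIntegral_indicator (hBm N)]; simp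
    _ ≤ ∫⁻ x in {x | 0 < filling μ f b N x}, b x ∂lam := lintegral_mono_set hsub
    _ ≤ _ := setLIntegral_filling_pos_le μ hf hbm hfi N

end Maximal

/-! ### From `μ`-almost every `g` to all of `Γ`. -/

section Invariance

variable {Γ X : Type*} [TopologicalSpace X] [T2Space X] [LocallyCompactSpace X]
  [MeasurableSpace X] [BorelSpace X]
  [Group Γ] [TopologicalSpace Γ] [IsTopologicalGroup Γ] [MeasurableSpace Γ] [BorelSpace Γ]
  [MulAction Γ X] [ContinuousSMul Γ X]

/-- The elements preserving a set of finite measure up to null sets form a closed subgroup. -/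
theorem isInvariantSet_of_ae (lam : Measure X) [lam.Regular] [SMulInvariantMeasure Γ X lam]
    (μ : Measure Γ) (hgen : SupportGenerates μ) {A : Set X} (hA : MeasurableSet A)
    (hfin : lam A ≠ ∞) (hae : ∀ᵐ g ∂μ, (g • ·) ⁻¹' A =ᵐ[lam] A) : IsInvariantSet Γ lam A := by
  have hmp (g : Γ) : MeasurePreserving (fun x : X => g • x) lam lam := measurePreserving_smul g lam
  let S : Subgroup Γ :=
    { carrier := {g | (g • ·) ⁻¹' A =ᵐ[lam] A}
      one_mem' := by simpa using ae_eq_refl (μ := lam) A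
      mul_mem' := fun {g h} hg hh => by
        have h1 := ((hmp h).quasiMeasurePreserving.preimage_ae_eq hg).trans hh
        simpa only [Set.mem_ofPred_eq, Set.preimage_preimage, mul_smul] using h1
      inv_mem' := fun {g} hg => by
        have h1 := (hmp g⁻¹).quasiMeasurePreserving.preimage_ae_eq hg
        simp only [Set.preimage_preimage, smul_inv_smul, Set.preimage_id'] at h1
        exact h1.symm }
  -- Translation of a set of finite measure is continuous in measure, so its stabilizer up to null
  -- sets is closed.
  have hcl : IsClosed (S : Set Γ) :=
    isClosed_setOfPred_preimage_ae_eq (f := fun g : Γ => (⟨fun x => g • x, by fun_prop⟩ : C(X, X)))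
      (ContinuousMap.continuous_of_continuous_uncurry _
        (by simpa [Function.uncurry_def] using continuous_smul)) hmp A hA.nullMeasurableSet hfin
  have hsupp : μ.support ⊆ S := Measure.support_subset_of_isClosed hcl hae
  have htop : S = ⊤ := top_le_iff.1 <| hgen ▸
    Subgroup.topologicalClosure_minimal _ ((Subgroup.closure_le S).2 hsupp) hcl
  intro g
  have hg : g⁻¹ ∈ S := htop ▸ Subgroup.mem_top _
  rw [measure_symmDiff_eq_zero_iff, ← Set.preimage_smul_inv]
  exact hg

end Invariance

/-! ### Upper Cesàro limits and their superlevel sets. -/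

section Cesaro

variable {Γ X : Type*} [Group Γ] [MulAction Γ X] [MeasurableSpace Γ]

/-- The upper limit of the Cesàro averages of the iterates of the transition operator. -/
noncomputable def limsupAverage (μ : Measure Γ) (f : X → ℝ≥0∞) (x : X) : ℝ≥0∞ :=
  limsup (fun n : ℕ => (n : ℝ≥0∞)⁻¹ * transitionSum μ f n x) atTop

variable (μ : Measure Γ) [IsProbabilityMeasure μ]

theorem transitionSum_le_mul {f : X → ℝ≥0∞} {c : ℝ≥0∞} (hf : ∀ x, f x ≤ c) (n : ℕ) (x : X) :
    transitionSum μ f n x ≤ n * c :=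
  (Finset.sum_le_sum fun k _ => transition_iterate_le_const μ hf k x).trans_eq (by simp)

theorem average_le_const {f : X → ℝ≥0∞} {c : ℝ≥0∞} (hf : ∀ x, f x ≤ c) (n : ℕ) (x : X) :
    (n : ℝ≥0∞)⁻¹ * transitionSum μ f n x ≤ c := by
  calc _ ≤ (n : ℝ≥0∞)⁻¹ * (n * c) := by gcongr; exact transitionSum_le_mul μ hf n x
    _ ≤ 1 * c := by rw [← mul_assoc]; gcongr; exact ENNReal.inv_mul_le_one _
    _ = c := one_mul c

theorem limsupAverage_le_const {f : X → ℝ≥0∞} {c : ℝ≥0∞} (hf : ∀ x, f x ≤ c) (x : X) :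
    limsupAverage μ f x ≤ c :=
  limsup_le_of_le (by isBoundedDefault) (.of_forall fun n => average_le_const μ hf n x)

variable [MeasurableSpace X] [MeasurableSMul₂ Γ X]

theorem measurable_limsupAverage {f : X → ℝ≥0∞} (hf : Measurable f) :
    Measurable (limsupAverage μ f) :=
  Measurable.limsup fun n => (measurable_transitionSum μ hf n).const_mul _

/-- The upper limit of the Cesàro averages is subharmonic. -/
theorem limsupAverage_le_transition {f : X → ℝ≥0∞} (hf : Measurable f) {c : ℝ≥0∞} (hc : c ≠ ∞)
    (hfc : ∀ x, f x ≤ c) (x : X) :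
    limsupAverage μ f x ≤ transition μ (limsupAverage μ f) x := by
  have hS := measurable_transitionSum μ hf
  -- Averaging commutes with the operator up to the boundary term `f x / n ≤ c / n`.
  have hle (n : ℕ) : (n : ℝ≥0∞)⁻¹ * transitionSum μ f n x ≤
      (n : ℝ≥0∞)⁻¹ * c + transition μ (fun y => (n : ℝ≥0∞)⁻¹ * transitionSum μ f n y) x := by
    rw [transition_const_mul μ _ (hS n), ← mul_add]
    gcongr
    calc transitionSum μ f n x ≤ transitionSum μ f (n + 1) x :=
          Finset.sum_le_sum_of_subset (Finset.range_mono n.le_succ)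
      _ = f x + transition μ (transitionSum μ f n) x := by rw [transitionSum_succ μ hf]; rfl
      _ ≤ _ := by gcongr; exact hfc x
  have h0 : Tendsto (fun n : ℕ => (n : ℝ≥0∞)⁻¹ * c) atTop (𝓝 0) := by
    simpa using ENNReal.Tendsto.mul_const ENNReal.tendsto_inv_nat_nhds_zero (Or.inr hc)
  -- Reverse Fatou, with the constant `c` as dominating function.
  have hF : limsup (fun n : ℕ =>
      transition μ (fun y => (n : ℝ≥0∞)⁻¹ * transitionSum μ f n y) x) atTop ≤
      transition μ (limsupAverage μ f) x :=
    limsup_lintegral_le (fun _ => c)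
      (fun n => ((hS n).comp (by fun_prop : Measurable fun g : Γ => g • x)).const_mul _)
      (fun n => .of_forall fun g => average_le_const μ hfc n _) (by simpa using hc)
  refine le_trans ?_ hF
  rw [← ENNReal.limsup_add_of_left_tendsto_zero h0]
  exact limsup_le_limsup (.of_forall hle)

theorem measure_lt_limsupAverage_ne_top {lam : Measure X} [SFinite lam]
    [SMulInvariantMeasure Γ X lam] {f : X → ℝ≥0∞} (hf : Measurable f)
    (hfi : ∫⁻ x, f x ∂lam ≠ ∞) {ε : ℝ≥0∞} (hε : ε ≠ 0) :
    lam {x | ε < limsupAverage μ f x} ≠ ∞ := by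
  have hle := mul_measure_exists_transitionSum_le (lam := lam) μ hf hfi ε
  have hsub : {x | ε < limsupAverage μ f x} ⊆
      {x | ∃ n : ℕ, n * ε < transitionSum μ f n x} := by
    intro x hx
    obtain ⟨n, hn, hn0⟩ := ((frequently_lt_of_lt_limsup (by isBoundedDefault)
      (show ε < limsup _ atTop from hx)).and_eventually
      (eventually_gt_atTop 0)).exists
    refine ⟨n, ?_⟩
    rw [mul_comm, ← ENNReal.lt_div_iff_mul_lt (by simp [hn0.ne']) (by simp),
      ENNReal.div_eq_inv_mul]
    exact hn
  refine ne_top_of_le_ne_top (fun htop => ?_) (measure_mono hsub)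
  rw [htop, ENNReal.mul_top hε, top_le_iff] at hle
  exact hfi hle

theorem two_mul_mul_le_add_mul_self (a b : ℝ≥0∞) : 2 * (a * b) ≤ a * a + b * b := by
  rcases eq_or_ne a ∞ with rfl | ha
  · simp
  rcases eq_or_ne b ∞ with rfl | hb
  · simp
  lift a to NNReal using ha
  lift b to NNReal using hb
  norm_cast
  have := two_mul_le_add_sq (a : ℝ) b
  rw [← NNReal.coe_le_coe]
  push_cast
  linarith

theorem eq_of_two_mul_mul_eq {a b : ℝ≥0∞} (ha : a ≠ ∞) (hb : b ≠ ∞)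
    (h : 2 * (a * b) = a * a + b * b) : a = b := by
  lift a to NNReal using ha
  lift b to NNReal using hb
  norm_cast at h ⊢
  have h' : 2 * ((a : ℝ) * b) = a * a + b * b := by exact_mod_cast h
  have : ((a : ℝ) - b) ^ 2 = 0 := by linarith
  exact_mod_cast sub_eq_zero.1 (pow_eq_zero_iff two_ne_zero |>.1 this)

/-- A square-integrable subharmonic function is almost everywhere invariant. -/
theorem ae_ae_eq_of_le_transition {lam : Measure X} [SFinite lam]
    [SMulInvariantMeasure Γ X lam] {f : X → ℝ≥0∞} (hf : Measurable f) (hft : ∀ x, f x ≠ ∞)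
    (hsq : ∫⁻ x, f x * f x ∂lam ≠ ∞) (hle : ∀ x, f x ≤ transition μ f x) :
    ∀ᵐ g ∂μ, ∀ᵐ x ∂lam, f (g • x) = f x := by
  -- Informally `∬ (f(gx) - f(x))² = 2‖f‖² - 2⟨f, Pf⟩ ≤ 0`. To avoid subtraction in `ℝ≥0∞`, this is
  -- the equality case of `2ab ≤ a² + b²`.
  have hint : ∫⁻ p : Γ × X, f p.2 * f p.2 + f (p.1 • p.2) * f (p.1 • p.2) ∂(μ.prod lam) =
      2 * ∫⁻ x, f x * f x ∂lam := by
    rw [lintegral_prod _ (by fun_prop)]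
    have (g : Γ) : ∫⁻ x, f x * f x + f (g • x) * f (g • x) ∂lam = 2 * ∫⁻ x, f x * f x ∂lam := by
      rw [lintegral_add_left (by fun_prop),
        lintegral_comp_smul (f := fun x => f x * f x) (by fun_prop) g, two_mul]
    simp [this]
  have hint' : 2 * ∫⁻ x, f x * f x ∂lam ≤
      ∫⁻ p : Γ × X, 2 * (f p.2 * f (p.1 • p.2)) ∂(μ.prod lam) := by
    rw [lintegral_prod_symm _ (by fun_prop), ← lintegral_const_mul _ (by fun_prop)]
    refine lintegral_mono fun x => ?_
    calc 2 * (f x * f x) ≤ 2 * (f x * transition μ f x) := by gcongr; exact hle x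
      _ = ∫⁻ g, 2 * (f x * f (g • x)) ∂μ := by
        rw [lintegral_const_mul _ (by fun_prop), lintegral_const_mul _ (by fun_prop)]
        rfl
  have hae : (fun p : Γ × X => 2 * (f p.2 * f (p.1 • p.2))) =ᵐ[μ.prod lam]
      fun p => f p.2 * f p.2 + f (p.1 • p.2) * f (p.1 • p.2) := by
    refine ae_eq_of_ae_le_of_lintegral_le
      (.of_forall fun p => two_mul_mul_le_add_mul_self _ _) ?_ (by fun_prop) (hint.trans_le hint')
    refine ne_top_of_le_ne_top (ENNReal.mul_ne_top ENNReal.ofNat_ne_top hsq) (le_trans ?_ hint.le)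
    exact lintegral_mono fun p => two_mul_mul_le_add_mul_self _ _
  filter_upwards [Measure.ae_ae_of_ae_prod hae] with g hg
  filter_upwards [hg] with x hx
  exact (eq_of_two_mul_mul_eq (hft _) (hft _) hx).symm

/-- The upper limit itself need not be square-integrable. Truncated subtraction of `ε` keeps it
subharmonic and bounded, with support of finite measure. -/
theorem ae_preimage_lt_limsupAverage {lam : Measure X} [SFinite lam]
    [SMulInvariantMeasure Γ X lam] {f : X → ℝ≥0∞} (hf : Measurable f) {c : ℝ≥0∞} (hc : c ≠ ∞)
    (hfc : ∀ x, f x ≤ c) (hfi : ∫⁻ x, f x ∂lam ≠ ∞) {ε : ℝ≥0∞} (hε : ε ≠ 0) :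
    ∀ᵐ g ∂μ, (g • ·) ⁻¹' {x | ε < limsupAverage μ f x} =ᵐ[lam]
      {x | ε < limsupAverage μ f x} := by
  set φ := limsupAverage μ f with hφ
  have hφm : Measurable φ := measurable_limsupAverage μ hf
  have hφc : ∀ x, φ x ≤ c := limsupAverage_le_const μ hfc
  have hle (x : X) : φ x - ε ≤ transition μ (fun y => φ y - ε) x := by
    calc φ x - ε ≤ transition μ φ x - ∫⁻ _, ε ∂μ := by
          rw [lintegral_const, measure_univ, mul_one]
          gcongr
          exact limsupAverage_le_transition μ hf hc hfc x
      _ ≤ _ := lintegral_sub_le _ _ measurable_const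
  have hsq : ∫⁻ x, (φ x - ε) * (φ x - ε) ∂lam ≠ ∞ := by
    refine ne_top_of_le_ne_top (b := ∫⁻ x, {x | ε < φ x}.indicator (fun _ => c * c) x ∂lam) ?_ ?_
    · rw [lintegral_indicator (measurableSet_lt measurable_const hφm), setLIntegral_const]
      exact ENNReal.mul_ne_top (ENNReal.mul_ne_top hc hc)
        (measure_lt_limsupAverage_ne_top μ hf hfi hε)
    · refine lintegral_mono fun x => ?_
      by_cases hx : ε < φ x
      · rw [Set.indicator_of_mem (by exact hx)]
        gcongr <;> exact tsub_le_self.trans (hφc x)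
      · simp [tsub_eq_zero_of_le (not_lt.1 hx)]
  filter_upwards [ae_ae_eq_of_le_transition μ (hφm.sub_const ε)
    (fun x => ne_top_of_le_ne_top hc (tsub_le_self.trans (hφc x))) hsq hle] with g hg
  rw [eventuallyEq_set]
  filter_upwards [hg] with x hx
  change ε < φ (g • x) ↔ ε < φ x
  rw [← tsub_pos_iff_lt, hx, tsub_pos_iff_lt]

end Cesaro

/-! ### From Cesàro convergence to convergence. -/

section Tauberian

/-- A sequence of nonnegative reals whose Cesàro averages tend to zero tends to zero as soon as
its increments `d k` satisfy `∑ (k + 1) * d k ^ 2 < ∞`. -/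
theorem tendsto_zero_of_average_of_summable {b : ℕ → ℝ} (hb : ∀ n, 0 ≤ b n)
    (hsum : Summable fun k : ℕ => (k + 1 : ℝ) * (b k - b (k + 1)) ^ 2)
    (havg : Tendsto (fun n : ℕ => (n : ℝ)⁻¹ * ∑ k ∈ Finset.range n, b k) atTop (𝓝 0)) :
    Tendsto b atTop (𝓝 0) := by
  set g : ℕ → ℝ := fun k => (k + 1 : ℝ) * (b k - b (k + 1)) ^ 2 with hg
  have hg0 (k : ℕ) : 0 ≤ g k := by positivity
  set T : ℕ → ℝ := fun n => ∑' k, g (k + n) with hT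
  have hT0 : Tendsto T atTop (𝓝 0) := tendsto_sum_nat_add g
  -- Cauchy–Schwarz over `j < n` increments costs a factor `j`, absorbed by the weights `n + k + 1`.
  have hdiff (n j : ℕ) (hj : j < n) : b n ≤ b (n + j) + √(T n) := by
    have htel : b n - b (n + j) = ∑ k ∈ Finset.range j, (b (n + k) - b (n + k + 1)) := by
      have := Finset.sum_range_sub' (fun k => b (n + k)) j
      simpa [add_assoc] using this.symm
    have hle : (b n - b (n + j)) ^ 2 ≤ T n := by
      calc (b n - b (n + j)) ^ 2
          ≤ (Finset.range j).card * ∑ k ∈ Finset.range j, (b (n + k) - b (n + k + 1)) ^ 2 := by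
            rw [htel]; exact sq_sum_le_card_mul_sum_sq
        _ ≤ ∑ k ∈ Finset.range j, g (k + n) := by
            rw [Finset.card_range, Finset.mul_sum]
            refine Finset.sum_le_sum fun k _ => ?_
            have : (j : ℝ) ≤ n := by exact_mod_cast hj.le
            simp only [hg, add_comm k n]
            refine mul_le_mul_of_nonneg_right ?_ (sq_nonneg _)
            push_cast
            linarith [(Nat.cast_nonneg k : (0 : ℝ) ≤ k)]
        _ ≤ T n := ((summable_nat_add_iff n).2 hsum).sum_le_tsum _ fun k _ => hg0 _
    linarith [Real.le_sqrt_of_sq_le hle]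
  -- Average `hdiff` over `j < n`; the block from `n` to `2n` is at most the sum up to `2n`.
  have hmain : ∀ n : ℕ, 0 < n →
      b n ≤ 2 * (((2 * n : ℕ) : ℝ)⁻¹ * ∑ k ∈ Finset.range (2 * n), b k) + √(T n) := by
    intro n hn
    have h1 : ∑ j ∈ Finset.range n, b n ≤ ∑ j ∈ Finset.range n, (b (n + j) + √(T n)) :=
      Finset.sum_le_sum fun j hj => hdiff n j (Finset.mem_range.1 hj)
    rw [Finset.sum_add_distrib, Finset.sum_const, Finset.sum_const, Finset.card_range,
      nsmul_eq_mul, nsmul_eq_mul] at h1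
    have h2 : ∑ j ∈ Finset.range n, b (n + j) ≤ ∑ k ∈ Finset.range (2 * n), b k := by
      rw [two_mul, Finset.sum_range_add]
      linarith [Finset.sum_nonneg fun k (_ : k ∈ Finset.range n) => hb k]
    have hn' : (0 : ℝ) < n := by exact_mod_cast hn
    have h3 : (2 : ℝ) * (((2 * n : ℕ) : ℝ)⁻¹ * ∑ k ∈ Finset.range (2 * n), b k) =
        (∑ k ∈ Finset.range (2 * n), b k) / n := by
      push_cast; field_simp
    rw [h3, ← sub_le_iff_le_add, le_div_iff₀ hn']
    linarith
  have hlim : Tendsto (fun n : ℕ =>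
      2 * (((2 * n : ℕ) : ℝ)⁻¹ * ∑ k ∈ Finset.range (2 * n), b k) + √(T n)) atTop (𝓝 0) := by
    have h1 := (havg.comp (tendsto_id.const_mul_atTop' two_pos)).const_mul 2
    have h2 := hT0.sqrt
    simpa using h1.add h2
  exact tendsto_of_tendsto_of_tendsto_of_le_of_le' tendsto_const_nhds hlim (.of_forall hb)
    ((eventually_gt_atTop 0).mono hmain)

theorem sum_succ_mul_second_difference_le {a : ℕ → ℝ} (h0 : ∀ n, 0 ≤ a n)
    (h1 : ∀ n, a (n + 1) ≤ a n) (h2 : ∀ n, 0 ≤ a n - 2 * a (n + 1) + a (n + 2)) (N : ℕ) :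
    ∑ k ∈ Finset.range N, (k + 1 : ℝ) * (a (2 * k) - 2 * a (2 * k + 1) + a (2 * k + 2)) ≤ a 0 := by
  -- The boundary term makes the induction close: the step needs exactly convexity at `2N + 1`,
  -- weighted by `N + 1`, and one decrease.
  have key : ∑ k ∈ Finset.range N,
      (k + 1 : ℝ) * (a (2 * k) - 2 * a (2 * k + 1) + a (2 * k + 2)) ≤
      a 0 - a (2 * N) - N * (a (2 * N) - a (2 * N + 1)) := by
    induction N with
    | zero => simp
    | succ N ih =>
      rw [Finset.sum_range_succ]
      have e1 := h1 (2 * N + 1)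
      have e2 := mul_nonneg (by positivity : (0 : ℝ) ≤ N + 1) (h2 (2 * N + 1))
      rw [show 2 * (N + 1) = 2 * N + 1 + 1 by ring]
      push_cast
      simp only [add_assoc, Nat.reduceAdd] at *
      linarith
  have := mul_nonneg (Nat.cast_nonneg N : (0 : ℝ) ≤ N) (sub_nonneg.2 (h1 (2 * N)))
  linarith [h0 (2 * N)]

end Tauberian

/-! ### Square-function estimate for symmetric `μ`. -/

section Symmetric

variable {Γ X : Type*} [Group Γ] [MulAction Γ X] [MeasurableSpace Γ] [MeasurableSpace X]
  [MeasurableSMul₂ Γ X] (μ : Measure Γ) [IsProbabilityMeasure μ]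
  {lam : Measure X} [SFinite lam] [SMulInvariantMeasure Γ X lam]

/-- Jensen for the square: integrate `2ab ≤ a² + b²` with `a` the mean of `b`, and cancel the finite
`a²`. -/
theorem transition_mul_self_le {f : X → ℝ≥0∞} (hf : Measurable f) {x : X}
    (hx : transition μ f x ≠ ∞) :
    transition μ f x * transition μ f x ≤ transition μ (f * f) x := by
  set a := transition μ f x with ha
  refine ENNReal.le_of_add_le_add_left (ENNReal.mul_ne_top hx hx) ?_
  calc a * a + a * a = ∫⁻ g, 2 * (a * f (g • x)) ∂μ := by
        rw [lintegral_const_mul _ (by fun_prop), lintegral_const_mul _ (by fun_prop), two_mul, ha,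
          transition]
    _ ≤ ∫⁻ g, a * a + f (g • x) * f (g • x) ∂μ :=
        lintegral_mono fun g => two_mul_mul_le_add_mul_self _ _
    _ = a * a + transition μ (f * f) x := by
        rw [lintegral_add_left measurable_const, lintegral_const, measure_univ, mul_one]
        rfl

theorem lintegral_iterate_mul_ne_top {f : X → ℝ≥0∞} (hf : Measurable f) {c : ℝ≥0∞} (hc : c ≠ ∞)
    (hfc : ∀ x, f x ≤ c) (hfi : ∫⁻ x, f x ∂lam ≠ ∞) (n m : ℕ) :
    ∫⁻ x, (transition μ)^[n] f x * (transition μ)^[m] f x ∂lam ≠ ∞ := by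
  refine ne_top_of_le_ne_top (ENNReal.mul_ne_top hc hfi) ?_
  rw [← lintegral_transition_iterate μ hf m,
    ← lintegral_const_mul _ (measurable_transition_iterate μ hf m)]
  refine lintegral_mono fun x => ?_
  gcongr
  exact transition_iterate_le_const μ hfc n x

variable [MeasurableInv Γ]

theorem lintegral_iterate_mul_iterate (hμ : μ.inv = μ) {f : X → ℝ≥0∞} (hf : Measurable f)
    (n m : ℕ) :
    ∫⁻ x, (transition μ)^[n] f x * (transition μ)^[m] f x ∂lam =
      ∫⁻ x, f x * (transition μ)^[n + m] f x ∂lam := by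
  induction n generalizing m with
  | zero => simp
  | succ n ih =>
    rw [Function.iterate_succ_apply',
      lintegral_transition_mul_comm μ hμ (measurable_transition_iterate μ hf n)
        (measurable_transition_iterate μ hf m), ← Function.iterate_succ_apply' (f := transition μ), ih,
      Nat.succ_add_eq_add_succ]

/-- By self-adjointness both sides are squared `L²` norms of consecutive iterates, and the operator
is an `L²` contraction. -/
theorem lintegral_mul_iterate_two_mul_succ_le (hμ : μ.inv = μ) {f : X → ℝ≥0∞} (hf : Measurable f)
    {c : ℝ≥0∞} (hc : c ≠ ∞) (hfc : ∀ x, f x ≤ c) (n : ℕ) :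
    ∫⁻ x, f x * (transition μ)^[2 * (n + 1)] f x ∂lam ≤
      ∫⁻ x, f x * (transition μ)^[2 * n] f x ∂lam := by
  have hm := measurable_transition_iterate μ hf
  rw [two_mul, two_mul, ← lintegral_iterate_mul_iterate μ hμ hf,
    ← lintegral_iterate_mul_iterate μ hμ hf, Function.iterate_succ_apply']
  refine le_trans ?_ (lintegral_transition (lam := lam) μ ((hm n).mul (hm n))).le
  refine lintegral_mono fun x => transition_mul_self_le μ (hm n) (ne_top_of_le_ne_top hc ?_)
  rw [← Function.iterate_succ_apply' (f := transition μ)]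
  exact transition_iterate_le_const μ hfc (n + 1) x

theorem ae_summable_sq_sub (hμ : μ.inv = μ) {f : X → ℝ≥0∞} (hf : Measurable f)
    {c : ℝ≥0∞} (hc : c ≠ ∞) (hfc : ∀ x, f x ≤ c) (hfi : ∫⁻ x, f x ∂lam ≠ ∞) :
    ∀ᵐ x ∂lam, Summable fun k : ℕ => (k + 1 : ℝ) *
      (((transition μ)^[2 * k] f x).toReal - ((transition μ)^[2 * (k + 1)] f x).toReal) ^ 2 := by
  set F : ℕ → X → ℝ := fun n x => ((transition μ)^[n] f x).toReal with hF
  set C : ℕ → ℝ := fun j => (∫⁻ x, f x * (transition μ)^[j] f x ∂lam).toReal with hC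
  have hm := measurable_transition_iterate μ hf
  have hFm (n : ℕ) : Measurable (F n) := (hm n).ennreal_toReal
  have hi (n m : ℕ) : Integrable (fun x => F n x * F m x) lam := by
    simp_rw [hF, ← ENNReal.toReal_mul]
    exact integrable_toReal_of_lintegral_ne_top ((hm n).mul (hm m)).aemeasurable
      (lintegral_iterate_mul_ne_top μ hf hc hfc hfi n m)
  have hint (n m : ℕ) : ∫ x, F n x * F m x ∂lam = C (n + m) := by
    simp_rw [hF, ← ENNReal.toReal_mul]
    refine (integral_toReal ((hm n).mul (hm m)).aemeasurable
      (ae_lt_top ((hm n).mul (hm m))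
        (lintegral_iterate_mul_ne_top μ hf hc hfc hfi n m))).trans ?_
    exact congrArg ENNReal.toReal (lintegral_iterate_mul_iterate μ hμ hf n m)
  have hsq (n m : ℕ) : (fun x => (F n x - F m x) ^ 2) =
      fun x => F n x * F n x - 2 * (F n x * F m x) + F m x * F m x := by ext x; ring
  have hisq (n m : ℕ) : Integrable (fun x => (F n x - F m x) ^ 2) lam := by
    rw [hsq]
    exact ((hi n n).sub ((hi n m).const_mul 2)).add (hi m m)
  have hintsq (n m : ℕ) : ∫ x, (F n x - F m x) ^ 2 ∂lam =
      C (n + n) - 2 * C (n + m) + C (m + m) := by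
    rw [hsq]
    refine (integral_add ((hi n n).sub ((hi n m).const_mul 2)) (hi m m)).trans ?_
    rw [integral_sub' (hi n n) ((hi n m).const_mul 2), integral_const_mul, hint, hint, hint]
  have hbound (N : ℕ) : ∑ k ∈ Finset.range N,
      ∫ x, (k + 1 : ℝ) * (F (2 * k) x - F (2 * (k + 1)) x) ^ 2 ∂lam ≤ C 0 := by
    -- Second differences of `C (2 * n)` are `‖P^n f - P^(n+2) f‖²`, hence nonnegative; those at `n
    -- = 2k` are the terms summed.
    have h := sum_succ_mul_second_difference_le (a := fun n => C (2 * n))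
      (fun n => ENNReal.toReal_nonneg)
      (fun n => ENNReal.toReal_mono
        (by simpa using lintegral_iterate_mul_ne_top μ hf hc hfc hfi 0 (2 * n))
        (lintegral_mul_iterate_two_mul_succ_le μ hμ hf hc hfc n))
      (fun n => by
        have := (hintsq n (n + 2)).symm.trans_ge (integral_nonneg fun x => sq_nonneg _)
        convert this using 3 <;> ring_nf) N
    refine le_trans (le_of_eq (Finset.sum_congr rfl fun k _ => ?_)) h
    rw [integral_const_mul, hintsq]
    ring_nf
  have hfin : ∫⁻ x, ∑' k : ℕ,
      ENNReal.ofReal ((k + 1 : ℝ) * (F (2 * k) x - F (2 * (k + 1)) x) ^ 2) ∂lam ≠ ∞ := by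
    rw [lintegral_tsum fun k => by fun_prop]
    refine ne_top_of_le_ne_top (ENNReal.ofReal_ne_top (r := C 0)) ?_
    rw [ENNReal.tsum_eq_iSup_nat]
    refine iSup_le fun N => ?_
    refine le_trans (le_of_eq ?_) (ENNReal.ofReal_le_ofReal (hbound N))
    rw [ENNReal.ofReal_sum_of_nonneg fun k _ => integral_nonneg fun x => by positivity]
    refine Finset.sum_congr rfl fun k _ => ?_
    rw [ofReal_integral_eq_lintegral_ofReal ((hisq _ _).const_mul _)
      (.of_forall fun x => by positivity)]
  filter_upwards [ae_lt_top (by fun_prop) hfin] with x hx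
  refine (ENNReal.summable_toReal hx.ne).congr fun k => ?_
  rw [ENNReal.toReal_ofReal (by positivity)]

end Symmetric

theorem tendsto_of_tendsto_even_odd {α : Type*} {l : Filter α} {u : ℕ → α}
    (he : Tendsto (fun n => u (2 * n)) atTop l) (ho : Tendsto (fun n => u (2 * n + 1)) atTop l) :
    Tendsto u atTop l := by
  intro s hs
  obtain ⟨N, hN⟩ := eventually_atTop.1 ((he.eventually_mem hs).and (ho.eventually_mem hs))
  refine mem_map.2 (mem_atTop_sets.2 ⟨2 * N, fun n hn => ?_⟩)
  rcases Nat.even_or_odd' n with ⟨k, rfl | rfl⟩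
  · exact (hN k (by omega)).1
  · exact (hN k (by omega)).2

/-- The real Cesàro averages of the even iterates are dominated by those of all iterates. -/
theorem tendsto_real_average_even (u : ℕ → ℝ≥0∞) {c : ℝ≥0∞} (hc : c ≠ ∞) (hu : ∀ n, u n ≤ c)
    (h : Tendsto (fun n : ℕ => (n : ℝ≥0∞)⁻¹ * ∑ k ∈ Finset.range n, u k) atTop (𝓝 0)) :
    Tendsto (fun n : ℕ => (n : ℝ)⁻¹ * ∑ k ∈ Finset.range n, (u (2 * k)).toReal) atTop (𝓝 0) := by
  have h1 : Tendsto (fun n : ℕ => (n : ℝ)⁻¹ * ∑ k ∈ Finset.range n, (u k).toReal) atTop (𝓝 0) := by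
    refine ((ENNReal.tendsto_toReal ENNReal.zero_ne_top).comp h).congr fun n => ?_
    simp [ENNReal.toReal_sum fun k _ => ne_top_of_le_ne_top hc (hu k)]
  have h2 := (h1.comp (tendsto_id.const_mul_atTop' two_pos)).const_mul 2
  rw [mul_zero] at h2
  refine squeeze_zero (fun n => by positivity) (fun n => ?_) h2
  have h3 : ∑ k ∈ Finset.range n, (u (2 * k)).toReal ≤
      ∑ k ∈ Finset.range (2 * n), (u k).toReal := by
    rw [← Finset.sum_image (f := fun k => (u k).toReal) (g := fun k => 2 * k)
      (fun _ _ _ _ => by simp)]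
    refine Finset.sum_le_sum_of_subset_of_nonneg (fun k hk => ?_)
      fun _ _ _ => ENNReal.toReal_nonneg
    simp only [Finset.mem_image, Finset.mem_range] at hk ⊢
    omega
  simp only [Function.comp_apply, id]
  push_cast
  rw [mul_inv, ← mul_assoc, ← mul_assoc, mul_inv_cancel₀ two_ne_zero, one_mul]
  gcongr

/-- Testing on countably many compact sets lets a single null set of starting points serve all test
functions. -/
theorem weakStarTendsto_zero {X : Type*} [TopologicalSpace X] [T2Space X] [MeasurableSpace X]
    [BorelSpace X] (K : CompactExhaustion X) {ν : ℕ → Measure X}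
    (h : ∀ m, Tendsto (fun n => ν n (K m)) atTop (𝓝 0)) : WeakStarTendsto ν 0 := by
  intro f
  obtain ⟨m, hm⟩ := K.exists_superset_of_isCompact f.hasCompactSupport.isCompact
  obtain ⟨c, hc⟩ := f.hasCompactSupport.exists_bound_of_continuous f.continuous
  rw [integral_zero_measure, tendsto_zero_iff_enorm_tendsto_zero]
  have hlim : Tendsto (fun n => ENNReal.ofReal c * ν n (K m)) atTop (𝓝 0) := by
    simpa using ENNReal.Tendsto.const_mul (h m) (Or.inr ENNReal.ofReal_ne_top)
  refine tendsto_of_tendsto_of_tendsto_of_le_of_le tendsto_const_nhds hlim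
    (fun _ => zero_le) fun n => ?_
  calc ‖∫ y, f y ∂(ν n)‖ₑ ≤ ∫⁻ y, ‖f y‖ₑ ∂(ν n) := enorm_integral_le_lintegral_enorm _
    _ ≤ ∫⁻ y, (K m).indicator (fun _ => ENNReal.ofReal c) y ∂(ν n) := by
        refine lintegral_mono fun y => ?_
        by_cases hy : y ∈ K m
        · rw [Set.indicator_of_mem hy, ← ofReal_norm]
          exact ENNReal.ofReal_le_ofReal (hc y)
        · rw [image_eq_zero_of_notMem_tsupport fun h => hy (hm h)]
          simp
    _ = ENNReal.ofReal c * ν n (K m) := by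
        rw [lintegral_indicator (K.isCompact m).measurableSet, setLIntegral_const]

/-! ### Almost everywhere convergence of averages and iterates. -/

section Main

variable {X Γ : Type*}
    [TopologicalSpace X] [T2Space X] [LocallyCompactSpace X] [SecondCountableTopology X]
    [MeasurableSpace X] [BorelSpace X]
    [Group Γ] [TopologicalSpace Γ] [IsTopologicalGroup Γ]
    [MeasurableSpace Γ] [BorelSpace Γ]
    [MulAction Γ X] [ContinuousSMul Γ X]
    (lam : Measure X) [lam.Regular] [SMulInvariantMeasure Γ X lam]
    (μ : Measure Γ) [IsProbabilityMeasure μ]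

theorem ae_tendsto_average_zero (hgen : SupportGenerates μ)
    (hinv : ∀ A : Set X, MeasurableSet A → IsInvariantSet Γ lam A → lam A = 0 ∨ lam A = ∞)
    {f : X → ℝ≥0∞} (hf : Measurable f) {c : ℝ≥0∞} (hc : c ≠ ∞) (hfc : ∀ x, f x ≤ c)
    (hfi : ∫⁻ x, f x ∂lam ≠ ∞) :
    ∀ᵐ x ∂lam, Tendsto (fun n : ℕ => (n : ℝ≥0∞)⁻¹ * transitionSum μ f n x) atTop (𝓝 0) := by
  have hnull (m : ℕ) : ∀ᵐ x ∂lam, limsupAverage μ f x ≤ (m + 1 : ℝ≥0∞)⁻¹ := by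
    have hε : (m + 1 : ℝ≥0∞)⁻¹ ≠ 0 := by simp
    have hA : MeasurableSet {x | (m + 1 : ℝ≥0∞)⁻¹ < limsupAverage μ f x} :=
      measurableSet_lt measurable_const (measurable_limsupAverage μ hf)
    have hfin := measure_lt_limsupAverage_ne_top (lam := lam) μ hf hfi hε
    have h0 := (hinv _ hA (isInvariantSet_of_ae lam μ hgen hA hfin
      (ae_preimage_lt_limsupAverage μ hf hc hfc hfi hε))).resolve_right hfin
    filter_upwards [measure_eq_zero_iff_ae_notMem.1 h0] with x hx using not_lt.1 hx
  filter_upwards [ae_all_iff.2 hnull] with x hx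
  have hlim : Tendsto (fun m : ℕ => (m + 1 : ℝ≥0∞)⁻¹) atTop (𝓝 0) := by
    exact_mod_cast ENNReal.tendsto_inv_nat_nhds_zero.comp (tendsto_add_atTop_nat 1)
  refine tendsto_of_le_liminf_of_limsup_le zero_le (ge_of_tendsto' hlim hx)

theorem ae_tendsto_iterate_two_mul_zero (hgen : SupportGenerates μ)
    (hinv : ∀ A : Set X, MeasurableSet A → IsInvariantSet Γ lam A → lam A = 0 ∨ lam A = ∞)
    (hμ : μ.inv = μ) {f : X → ℝ≥0∞} (hf : Measurable f) {c : ℝ≥0∞} (hc : c ≠ ∞)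
    (hfc : ∀ x, f x ≤ c) (hfi : ∫⁻ x, f x ∂lam ≠ ∞) :
    ∀ᵐ x ∂lam, Tendsto (fun n : ℕ => (transition μ)^[2 * n] f x) atTop (𝓝 0) := by
  filter_upwards [ae_tendsto_average_zero lam μ hgen hinv hf hc hfc hfi,
    ae_summable_sq_sub μ hμ hf hc hfc hfi] with x hx hx'
  have hle (n : ℕ) := transition_iterate_le_const μ hfc n x
  have h := tendsto_zero_of_average_of_summable (fun n => ENNReal.toReal_nonneg) hx'
    (tendsto_real_average_even (fun k => (transition μ)^[k] f x) hc hle hx)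
  rwa [← ENNReal.toReal_zero, ENNReal.tendsto_toReal_iff
    (fun n => ne_top_of_le_ne_top hc (hle _)) ENNReal.zero_ne_top] at h

theorem ae_tendsto_iterate_zero (hgen : SupportGenerates μ)
    (hinv : ∀ A : Set X, MeasurableSet A → IsInvariantSet Γ lam A → lam A = 0 ∨ lam A = ∞)
    (hμ : μ.inv = μ) {f : X → ℝ≥0∞} (hf : Measurable f) {c : ℝ≥0∞} (hc : c ≠ ∞)
    (hfc : ∀ x, f x ≤ c) (hfi : ∫⁻ x, f x ∂lam ≠ ∞) :
    ∀ᵐ x ∂lam, Tendsto (fun n : ℕ => (transition μ)^[n] f x) atTop (𝓝 0) := by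
  filter_upwards [ae_tendsto_iterate_two_mul_zero lam μ hgen hinv hμ hf hc hfc hfi,
    -- The odd iterates of `f` are the even iterates of `transition μ f`, which has the same bound
    -- and integral.
    ae_tendsto_iterate_two_mul_zero lam μ hgen hinv hμ (measurable_transition μ hf) hc
      (transition_iterate_le_const μ hfc 1) (by rwa [lintegral_transition μ hf])] with x he ho
  exact tendsto_of_tendsto_even_odd he ho

end Main

end RandomWalk

theorem theorem1 {X Γ : Type*}
    [TopologicalSpace X] [T2Space X] [LocallyCompactSpace X] [SecondCountableTopology X]
    [MeasurableSpace X] [BorelSpace X]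
    [Group Γ] [TopologicalSpace Γ] [IsTopologicalGroup Γ]
    [LocallyCompactSpace Γ] [SecondCountableTopology Γ]
    [MeasurableSpace Γ] [BorelSpace Γ]
    [MulAction Γ X] [ContinuousSMul Γ X]
    (lam : Measure X) [lam.Regular] [SMulInvariantMeasure Γ X lam]
    (μ : Measure Γ) [IsProbabilityMeasure μ]
    (hgen : RandomWalk.SupportGenerates μ)
    (hinv : ∀ A : Set X, MeasurableSet A → RandomWalk.IsInvariantSet Γ lam A →
      lam A = 0 ∨ lam A = ∞) :
    (μ.inv = μ →
      ∀ᵐ x ∂lam, RandomWalk.WeakStarTendsto (fun n => RandomWalk.walkLaw μ n x) 0) ∧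
    (∀ᵐ x ∂lam, RandomWalk.WeakStarTendsto (fun n => RandomWalk.cesaroLaw μ n x) 0) := by

  let K : CompactExhaustion X := default
  have hK (m : ℕ) : MeasurableSet (K m) := (K.isCompact m).measurableSet
  have hm (m : ℕ) : Measurable ((K m).indicator (1 : X → ℝ≥0∞)) := measurable_one.indicator (hK m)
  have hle (m : ℕ) (x : X) : (K m).indicator (1 : X → ℝ≥0∞) x ≤ 1 :=
    Set.indicator_le_self' (fun _ _ => zero_le) x
  have hi (m : ℕ) : ∫⁻ x, (K m).indicator (1 : X → ℝ≥0∞) x ∂lam ≠ ∞ := by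
    rw [lintegral_indicator_one (hK m)]
    exact (K.isCompact m).measure_ne_top
  constructor
  · intro hμ
    filter_upwards [ae_all_iff.2 fun m => RandomWalk.ae_tendsto_iterate_zero lam μ hgen hinv hμ
      (hm m) ENNReal.one_ne_top (hle m) (hi m)] with x hx
    refine RandomWalk.weakStarTendsto_zero K fun m => ?_
    simpa only [RandomWalk.walkLaw_apply μ _ x (hK m)] using hx m
  · filter_upwards [ae_all_iff.2 fun m => RandomWalk.ae_tendsto_average_zero lam μ hgen hinv
      (hm m) ENNReal.one_ne_top (hle m) (hi m)] with x hx
    refine RandomWalk.weakStarTendsto_zero K fun m => (hx m).congr fun n => ?_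
    simp only [RandomWalk.cesaroLaw, Measure.smul_apply, Measure.finsetSum_apply, smul_eq_mul,
      RandomWalk.walkLaw_apply μ _ x (hK m), RandomWalk.transitionSum]
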